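/- Let $X_0$ be a real or complex Banach space and let $\tau$ be a Hausdorff locally convex topology on $X_0$ such that $\tau$ is coarser than the norm topology, $\tau$ is sequentially complete on the closed unit ball, and the dual of $(X_0,\tau)$ is norming, i.e. $\|x\|=\sup\{|\varphi(x)| : \varphi\in(X_0,\tau)',\ \|\varphi\|\le 1\}$ for all $x\in X_0$. Let $(T(t))_{t\ge 0}$ be a bi-continuous semigroup of bounded linear operators on $X_0$ with respect to $\tau$; that is, $T(0)=I$ and $T(t+s)=T(t)T(s)$; $t\mapsto T(t)x$ is $\tau$-continuous on $[0,\infty)$ for each $x\in X_0$; $\|T(t)\|\le Me^{\omega t}$ for some $M\ge 1$, $\omega\in\mathbb R$ and all $t\ge 0$; and whenever $(x_n)$ is a norm-bounded sequence with $x_n\to 0$ in $\tau$, then for each $t_0\ge 0$, $T(s)x_n\to 0$ in $\tau$ uniformly for $s\in[0,t_0]$. Suppose that $(T(t))_{t\ge0}$ has negative growth bound, i.e. the exponential bound holds for some $M\ge1$ and $\omega<0$. Let $A$ be its generator, $$Ax=\tau\text{-}\lim_{t\downarrow 0}\frac{T(t)x-x}{t},\qquad D(A)=\Bigl\{x\in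 X_0:\ \tau\text{-}\lim_{t\downarrow 0}\frac{T(t)x-x}{t}\ \text{exists and}\ \sup_{t\in(0,1]}\frac{\|T(t)x-x\|}{t}<\infty\Bigr\}.$$ For $\alpha\in(0,1)$ let $$X_\alpha:=\Bigl\{x\in X_0:\ \tau\text{-}\lim_{t\downarrow0}\frac{T(t)x-x}{t^\alpha}=0\ \text{ and }\ \sup_{t>0}\frac{\|T(t)x-x\|}{t^\alpha}<\infty\Bigr\}.$$ Then every $\lambda>0$ lies in the resolvent set of $A$, and, with $R(\lambda,A)=(\lambda-A)^{-1}$, $$X_\alpha=\Bigl\{x\in X_0:\ \tau\text{-}\lim_{\lambda\to\infty}\lambda^\alpha AR(\lambda,A)x=0\ \text{ and }\ \sup_{\lambda>0}\|\lambda^\alpha AR(\lambda,A)x\|<\infty\Bigr\}.$$ -/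

import Mathlib

open Filter Topology
open scoped NNReal

namespace BiCont

/-- A locally convex topology on a Banach space `X`, as used in the theory of bi-continuous
semigroups: a Hausdorff locally convex vector topology that is coarser than the norm topology,
sequentially complete on the closed norm unit ball, and has a norming dual. It is bundled (not a
type class), so that `X` itself keeps its norm topology: `X →L[𝕜] X` always refers to the norm. -/
structure AdmissibleTopology (𝕜 : Type*) [RCLike 𝕜] (X : Type*) [NormedAddCommGroup X]
    [NormedSpace 𝕜 X] where
  /-- the underlying topology `τ` -/
  top : TopologicalSpace X
  /-- `τ` is a locally convex vector topology, i.e. the topology generated by a family of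
  seminorms -/
  locallyConvex : @PolynormableSpace 𝕜 X _ _ _ top
  /-- `τ` is Hausdorff -/
  t2 : @T2Space X top
  /-- every `τ`-open set is open in the norm topology -/
  coarser : (PseudoMetricSpace.toUniformSpace.toTopologicalSpace : TopologicalSpace X) ≤ top
  /-- every `τ`-Cauchy sequence in the closed unit ball has a `τ`-limit in this ball -/
  seqComplete : ∀ u : ℕ → X, (∀ n, ‖u n‖ ≤ 1) →
    Tendsto (fun mn : ℕ × ℕ => u mn.1 - u mn.2) atTop (@nhds X top 0) →
    ∃ x : X, ‖x‖ ≤ 1 ∧ Tendsto u atTop (@nhds X top x)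
  /-- the dual of `(X, τ)` is norming: `‖x‖` is the supremum of `|φ x|` over all `τ`-continuous
  linear functionals `φ` with `‖φ‖ ≤ 1`, i.e. with `|φ y| ≤ ‖y‖` for all `y` -/
  norming : ∀ x : X, IsLUB {r : ℝ | ∃ φ : X →ₗ[𝕜] 𝕜,
    @Continuous X 𝕜 top _ φ ∧ (∀ y, ‖φ y‖ ≤ ‖y‖) ∧ r = ‖φ x‖} ‖x‖

section

variable {𝕜 : Type*} [RCLike 𝕜] {X : Type*} [NormedAddCommGroup X] [NormedSpace 𝕜 X]

/-- `(T(t))_{t ≥ 0}` is a bi-continuous semigroup with respect to the topology `τ`. -/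
structure IsBicontinuousSemigroup (τ : AdmissibleTopology 𝕜 X) (T : ℝ≥0 → X →L[𝕜] X) : Prop where
  map_zero : T 0 = ContinuousLinearMap.id 𝕜 X
  map_add : ∀ t s, T (t + s) = (T t).comp (T s)
  /-- strong `τ`-continuity -/
  strongCont : ∀ x, @Continuous ℝ≥0 X _ τ.top (fun t => T t x)
  /-- exponential boundedness -/
  expBdd : ∃ M ω : ℝ, 1 ≤ M ∧ ∀ t, ‖T t‖ ≤ M * Real.exp (ω * t)
  /-- local bi-equicontinuity: for norm-bounded `τ`-null sequences `u`, the convergence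
  `T s (u n) → 0` in `τ` is uniform for `s ∈ [0, t₀]` -/
  locBiequicont : ∀ u : ℕ → X, (∃ C : ℝ, ∀ n, ‖u n‖ ≤ C) → Tendsto u atTop (@nhds X τ.top 0) →
    ∀ t₀ : ℝ≥0, ∀ U ∈ @nhds X τ.top 0, ∀ᶠ n in atTop, ∀ s ≤ t₀, T s (u n) ∈ U

/-- The growth bound of `T` is negative: `‖T t‖ ≤ M exp (ω t)` for some `M ≥ 1` and `ω < 0`. -/
def HasNegativeGrowthBound (T : ℝ≥0 → X →L[𝕜] X) : Prop :=
  ∃ M ω : ℝ, 1 ≤ M ∧ ω < 0 ∧ ∀ t : ℝ≥0, ‖T t‖ ≤ M * Real.exp (ω * t)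

/-- The graph of the generator: all `(x, y)` such that `(T(t)x - x) / t → y` in `τ` as `t ↓ 0`
and `‖T(t)x - x‖ / t` is bounded on `(0, 1]`. -/
def generatorGraph (τ : AdmissibleTopology 𝕜 X) (T : ℝ≥0 → X →L[𝕜] X) :
    Submodule 𝕜 (X × X) where
  carrier := {z | Tendsto (fun t : ℝ≥0 => (((t : ℝ) : 𝕜))⁻¹ • (T t z.1 - z.1))
      (𝓝[>] 0) (@nhds X τ.top z.2) ∧
    ∃ C : ℝ, ∀ t : ℝ≥0, 0 < t → t ≤ 1 → ‖T t z.1 - z.1‖ / (t : ℝ) ≤ C}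
  add_mem' := by
    rintro ⟨x, y⟩ ⟨x', y'⟩ ⟨h, C, hC⟩ ⟨h', C', hC'⟩
    have := @WithSeminorms.topologicalAddGroup _ _ _ _ _ _ τ.top _ τ.locallyConvex.withSeminorms'
    refine ⟨?_, C + C', fun t ht ht1 => ?_⟩
    · have key := by let := τ.top; exact Filter.Tendsto.add h h'
      refine key.congr fun t => ?_
      simp only [Prod.fst_add, _root_.map_add, ← smul_add]
      congr 1
      abel
    · refine le_trans ?_ (add_le_add (hC t ht ht1) (hC' t ht ht1))
      rw [← add_div]
      have : T t (x + x') - (x + x') = (T t x - x) + (T t x' - x') := by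
        rw [_root_.map_add]; abel
      simp only [Prod.fst_add, this]
      gcongr
      exact norm_add_le _ _
  zero_mem' := by
    refine ⟨?_, 0, fun t _ _ => by simp⟩
    simp only [Prod.fst_zero, Prod.snd_zero, _root_.map_zero, sub_zero, smul_zero]
    let := τ.top
    exact tendsto_const_nhds
  smul_mem' := by
    rintro c ⟨x, y⟩ ⟨h, C, hC⟩
    have := @WithSeminorms.continuousSMul _ _ _ _ _ _ τ.top _ τ.locallyConvex.withSeminorms'
    refine ⟨?_, ‖c‖ * C, fun t ht ht1 => ?_⟩
    · have key := by let := τ.top; exact Filter.Tendsto.const_smul h c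
      refine key.congr fun t => ?_
      simp only [Prod.smul_fst, map_smul, ← smul_sub]
      rw [smul_comm]
    · have := mul_le_mul_of_nonneg_left (hC t ht ht1) (norm_nonneg c)
      refine le_trans (le_of_eq ?_) this
      simp only [Prod.smul_fst, map_smul, ← smul_sub, norm_smul, mul_div_assoc]

/-- The generator of `T`, an unbounded operator on `X`, see `mem_graph_generator_iff`. -/
noncomputable def generator (τ : AdmissibleTopology 𝕜 X)
    (T : ℝ≥0 → X →L[𝕜] X) : X →ₗ.[𝕜] X :=
  (generatorGraph τ T).toLinearPMap

theorem mem_graph_generator_iff (τ : AdmissibleTopology 𝕜 X)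
    (T : ℝ≥0 → X →L[𝕜] X) (x y : X) :
    (x, y) ∈ (generator τ T).graph ↔
      Tendsto (fun t : ℝ≥0 => (((t : ℝ) : 𝕜))⁻¹ • (T t x - x)) (𝓝[>] 0) (@nhds X τ.top y) ∧
      ∃ C : ℝ, ∀ t : ℝ≥0, 0 < t → t ≤ 1 → ‖T t x - x‖ / (t : ℝ) ≤ C := by
  have hg : ∀ z : X × X, z ∈ generatorGraph τ T → z.1 = 0 → z.2 = 0 := by
    rintro ⟨a, b⟩ ⟨h, -⟩ rfl
    simp only [_root_.map_zero, sub_zero, smul_zero] at h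
    exact @tendsto_nhds_unique _ _ τ.top τ.t2 _ _ _ _ inferInstance h
      (by let := τ.top; exact tendsto_const_nhds)
  rw [generator, Submodule.toLinearPMap_graph_eq _ hg]
  rfl

/-- `R` is the (bounded) inverse of `μ - A : D(A) → X`. -/
def IsResolventAt (A : X →ₗ.[𝕜] X) (μ : 𝕜) (R : X →L[𝕜] X) : Prop :=
  (∀ x, ∃ h : R x ∈ A.domain, μ • R x - A ⟨R x, h⟩ = x) ∧
    ∀ y : A.domain, R (μ • (y : X) - A y) = y

/-- The resolvent set `ρ(A)`. -/
def resolventSet (A : X →ₗ.[𝕜] X) : Set 𝕜 :=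
  {μ | ∃ R : X →L[𝕜] X, IsResolventAt A μ R}

open Classical in
/-- The resolvent `R(μ, A) = (μ - A)⁻¹` for `μ ∈ ρ(A)` (and `0` for other `μ`). -/
noncomputable def resolvent (A : X →ₗ.[𝕜] X) (μ : 𝕜) : X →L[𝕜] X :=
  if h : ∃ R : X →L[𝕜] X, IsResolventAt A μ R then h.choose else 0

open Classical in
/-- The value `A x` for `x ∈ D(A)` (and `0` for other `x`). It is only used for `x` in the range of
a resolvent of `A`, which is contained in `D(A)`. -/
noncomputable def value (A : X →ₗ.[𝕜] X) (x : X) : X :=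
  if h : x ∈ A.domain then A ⟨x, h⟩ else 0

/-- The abstract Hölder space `X_α` of the semigroup `T`: all `x` such that
`(T(t)x - x) / t ^ α → 0` in `τ` as `t ↓ 0` and `sup_{t > 0} ‖T(t)x - x‖ / t ^ α < ∞`. -/
def holderSpace (τ : AdmissibleTopology 𝕜 X) (T : ℝ≥0 → X →L[𝕜] X) (α : ℝ) : Set X :=
  {x | Tendsto (fun t : ℝ≥0 => ((((t : ℝ) ^ α : ℝ) : 𝕜))⁻¹ • (T t x - x)) (𝓝[>] 0) (@nhds X τ.top 0) ∧
    ∃ C : ℝ, ∀ t : ℝ≥0, 0 < t → ‖T t x - x‖ / (t : ℝ) ^ α ≤ C}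

end

end BiCont

/-! Negative growth makes `T` uniformly bounded by some `M`, so for every `l > 0` the Laplace
transform `R x = ∫ exp(-l t) T(t)x dt` exists and is the resolvent, with `A R x = l R x - x`. Two
quantitative estimates then link orbits and resolvent.

Orbit to resolvent (`IsLaplace.rpow_mul_seminorm_le`): `l R x - x = l ∫ exp(-l t) (T(t)x - x) dt`,
and integrating a bound `t ^ α` gives `Γ(α + 1) l ^ (-α)`. Resolvent to orbit
(`IsLaplace.seminorm_semigroup_sub_le`): take `l = 1 / t` and `y = A R x`, so that `x = l R x - y`
and `T(t)x - x = l ∫₀ᵗ T(s)y ds - (T(t)y - y)`; a bound `B` for `T(s)y` on `[0, t]` yields `3 B`.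
With the norm these give the two suprema; with `τ`-continuous seminorms they give the two limits,
local bi-equicontinuity controlling `T(s)y`.

The integrals are defined weakly. Since `T(h)` need not be `τ`-continuous, `τ`-continuous
functionals may not be stable under `φ ↦ φ ∘ T(h)`. The larger class `SeqCont` is stable
(`IsBicontinuousSemigroup.seqCont_comp`) and still norms `X`. Estimates are proved for every
`DualSeminorm`, which covers both the norm and the `τ`-continuous seminorms. -/

namespace BiCont

/-! ### Functionals and seminorms adapted to `τ` -/

section Functionals

variable {𝕜 : Type*} [RCLike 𝕜] {X : Type*} [NormedAddCommGroup X] [NormedSpace 𝕜 X]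

/-- A seminorm which is continuous for the topology `τ`. -/
def AdmissibleTopology.ContSeminorm (τ : AdmissibleTopology 𝕜 X) (p : Seminorm 𝕜 X) : Prop :=
  @Continuous X ℝ τ.top _ p

/-- Convergence in `τ` is convergence with respect to all `τ`-continuous seminorms. -/
theorem AdmissibleTopology.tendsto_iff (τ : AdmissibleTopology 𝕜 X) {ι : Type*} {l : Filter ι}
    {u : ι → X} {y : X} :
    Tendsto u l (@nhds X τ.top y) ↔
      ∀ p : Seminorm 𝕜 X, τ.ContSeminorm p → Tendsto (fun i => p (u i - y)) l (𝓝 0) := by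
  have h := by
    let := τ.top
    exact WithSeminorms.tendsto_nhds τ.locallyConvex.withSeminorms' u (f := l) y
  rw [h]
  constructor
  · intro h p hp
    rw [Metric.tendsto_nhds]
    intro ε hε
    filter_upwards [h ⟨p, hp⟩ ε hε] with i hi
    rw [Real.dist_eq, sub_zero, abs_of_nonneg (apply_nonneg _ _)]
    exact hi
  · rintro h ⟨p, hp⟩ ε hε
    filter_upwards [(Metric.tendsto_nhds.1 (h p hp)) ε hε] with i hi
    rw [Real.dist_eq, sub_zero, abs_of_nonneg (apply_nonneg _ _)] at hi
    exact hi

theorem AdmissibleTopology.tendsto_zero_iff (τ : AdmissibleTopology 𝕜 X) {ι : Type*}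
    {l : Filter ι} {u : ι → X} :
    Tendsto u l (@nhds X τ.top 0) ↔
      ∀ p : Seminorm 𝕜 X, τ.ContSeminorm p → Tendsto (fun i => p (u i)) l (𝓝 0) := by
  simp [τ.tendsto_iff]

theorem AdmissibleTopology.tendsto_sub_iff (τ : AdmissibleTopology 𝕜 X) {ι : Type*}
    {l : Filter ι} {u : ι → X} {y : X} :
    Tendsto (fun i => u i - y) l (@nhds X τ.top 0) ↔ Tendsto u l (@nhds X τ.top y) := by
  rw [τ.tendsto_zero_iff, τ.tendsto_iff]

theorem AdmissibleTopology.ContSeminorm.exists_bound {τ : AdmissibleTopology 𝕜 X}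
    {p : Seminorm 𝕜 X} (hp : τ.ContSeminorm p) : ∃ K : ℝ, 0 ≤ K ∧ ∀ x, p x ≤ K * ‖x‖ := by
  have hc : Continuous p := continuous_le_dom τ.coarser hp
  obtain ⟨C, hC, h⟩ := p.bound_of_continuous_normedSpace hc
  exact ⟨C, hC.le, h⟩

/-- Norm-continuous functionals that are sequentially `τ`-continuous on norm-bounded sets. -/
def AdmissibleTopology.SeqCont (τ : AdmissibleTopology 𝕜 X) (φ : X →L[𝕜] 𝕜) : Prop :=
  ∀ u : ℕ → X, (∃ C : ℝ, ∀ n, ‖u n‖ ≤ C) → Tendsto u atTop (@nhds X τ.top 0) →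
    Tendsto (fun n => φ (u n)) atTop (𝓝 0)

theorem AdmissibleTopology.SeqCont.tendsto {τ : AdmissibleTopology 𝕜 X} {φ : X →L[𝕜] 𝕜}
    (hφ : τ.SeqCont φ) {u : ℕ → X} {y : X} {C : ℝ} (hC : ∀ n, ‖u n‖ ≤ C)
    (hu : Tendsto u atTop (@nhds X τ.top y)) : Tendsto (fun n => φ (u n)) atTop (𝓝 (φ y)) := by
  have h := hφ (fun n => u n - y) ⟨C + ‖y‖, fun n => (norm_sub_le _ _).trans (by gcongr; exact hC n)⟩
    (τ.tendsto_sub_iff.2 hu)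
  simp only [map_sub] at h
  simpa using h.add_const (φ y)

/-- Seminorms that are determined by the functionals in `τ.SeqCont` which they dominate. -/
def AdmissibleTopology.DualSeminorm (τ : AdmissibleTopology 𝕜 X) (q : Seminorm 𝕜 X) : Prop :=
  ∀ (y : X) (B : ℝ), (∀ φ : X →L[𝕜] 𝕜, τ.SeqCont φ → (∀ z, ‖φ z‖ ≤ q z) → ‖φ y‖ ≤ B) → q y ≤ B

/-- A `τ`-continuous seminorm is determined by the functionals it dominates (Hahn-Banach). -/
theorem AdmissibleTopology.ContSeminorm.dualSeminorm {τ : AdmissibleTopology 𝕜 X}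
    {p : Seminorm 𝕜 X} (hp : τ.ContSeminorm p) : τ.DualSeminorm p := by
  intro y B h
  obtain ⟨K, -, hK⟩ := hp.exists_bound
  obtain ⟨g, hg, hgp⟩ : ∃ g : X →ₗ[𝕜] 𝕜, ‖g y‖ = p y ∧ ∀ x, ‖g x‖ ≤ p x := by
    by_cases hy : y = 0
    · exact ⟨0, by simp [hy], fun x => by simp⟩
    · let e := LinearEquiv.toSpanNonzeroSingleton 𝕜 X y hy
      let f : Module.Dual 𝕜 (Submodule.span 𝕜 {y}) := ((p y : ℝ) : 𝕜) • e.symm.toLinearMap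
      have hf : ∀ x, ‖f x‖ ≤ p x := by
        intro x
        obtain ⟨c, rfl⟩ := e.surjective x
        have h1 : (e c : X) = c • y := by simp [e]
        rw [h1, map_smul_eq_mul]
        simp [f, norm_smul, mul_comm, abs_of_nonneg (apply_nonneg p y)]
      obtain ⟨g, hg, hgp⟩ := Module.Dual.exists_extension_of_le_seminorm _ f hf
      refine ⟨g, ?_, hgp⟩
      have h1 : (e 1 : X) = y := by simp [e]
      have h2 := hg (e 1)
      rw [h1] at h2
      rw [h2]
      simp [f]
  let φ : X →L[𝕜] 𝕜 := g.mkContinuous K fun x => (hgp x).trans (hK x)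
  rw [← hg]
  refine h φ ?_ hgp
  intro u _ hu
  exact squeeze_zero_norm (fun n => hgp (u n)) (τ.tendsto_zero_iff.1 hu p hp)

/-- The functionals in the norming hypothesis are `τ`-continuous, hence belong to `SeqCont`. -/
theorem AdmissibleTopology.dualSeminorm_norm (τ : AdmissibleTopology 𝕜 X) :
    τ.DualSeminorm (normSeminorm 𝕜 X) := by
  intro y B h
  refine (τ.norming y).2 ?_
  rintro r ⟨φ, hφ, hn, rfl⟩
  refine h (φ.mkContinuous 1 fun x => by simpa using hn x) ?_ hn
  intro u _ hu
  have h0 : Tendsto φ (@nhds X τ.top 0) (𝓝 (φ 0)) := @Continuous.tendsto X 𝕜 τ.top _ _ hφ 0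
  rw [_root_.map_zero] at h0
  exact h0.comp hu

theorem AdmissibleTopology.ext_seqCont (τ : AdmissibleTopology 𝕜 X) {x y : X}
    (h : ∀ φ : X →L[𝕜] 𝕜, τ.SeqCont φ → φ x = φ y) : x = y := by
  have : ‖x - y‖ ≤ 0 := τ.dualSeminorm_norm (x - y) 0 fun φ hφ _ => by
    simp [map_sub, h φ hφ]
  exact sub_eq_zero.1 (norm_le_zero_iff.1 this)

end Functionals

/-! ### Riemann sums and bounded `τ`-Cauchy sequences -/

section Riemann

/-- Heine–Cantor on `[0, 1]` for the pseudometric of `p`. -/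
theorem exists_delta_of_seminorm_continuous {E : Type*} [AddCommGroup E] (p : AddGroupSeminorm E)
    {f : ℝ → E} (hf : ∀ t, Tendsto (fun s => p (f s - f t)) (𝓝 t) (𝓝 0)) {ε : ℝ} (hε : 0 < ε) :
    ∃ δ > 0, ∀ s ∈ Set.Icc (0 : ℝ) 1, ∀ t ∈ Set.Icc (0 : ℝ) 1, |s - t| < δ → p (f s - f t) < ε := by
  let := p.toSeminormedAddCommGroup
  have hc : Continuous f := by
    rw [continuous_iff_continuousAt]
    intro t
    exact tendsto_iff_norm_sub_tendsto_zero.2 (hf t)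
  have hu := isCompact_Icc.uniformContinuousOn_of_continuous (s := Set.Icc (0 : ℝ) 1) hc.continuousOn
  obtain ⟨δ, hδ, h⟩ := Metric.uniformContinuousOn_iff.1 hu ε hε
  refine ⟨δ, hδ, fun s hs t ht hst => ?_⟩
  have := h s hs t ht (by rwa [Real.dist_eq])
  rwa [dist_eq_norm] at this

/-- The error depends only on the oscillation at mesh `1 / n`, so it is uniform over all functionals
dominated by one seminorm. -/
theorem norm_riemannSum_sub_integral_le {E : Type*} [NormedAddCommGroup E] [NormedSpace ℝ E]
    [CompleteSpace E] {g : ℝ → E} (hg : Continuous g)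
    {n : ℕ} (hn : 0 < n) {ε : ℝ} (h : ∀ s ∈ Set.Icc (0 : ℝ) 1, ∀ t ∈ Set.Icc (0 : ℝ) 1,
      |s - t| ≤ 1 / n → ‖g s - g t‖ ≤ ε) :
    ‖(n : ℝ)⁻¹ • ∑ k ∈ Finset.range n, g (k / n) - ∫ t in (0 : ℝ)..1, g t‖ ≤ ε := by
  have hn' : (0 : ℝ) < n := by exact_mod_cast hn
  have h1 := intervalIntegral.sum_integral_adjacent_intervals (f := g) (μ := MeasureTheory.volume)
    (a := fun k : ℕ => (k : ℝ) / n) (n := n) fun k _ => hg.intervalIntegrable _ _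
  simp only [Nat.cast_zero, zero_div, div_self hn'.ne'] at h1
  rw [← h1, Finset.smul_sum, ← Finset.sum_sub_distrib]
  have h2 : ∀ k ∈ Finset.range n, ‖(n : ℝ)⁻¹ • g (k / n) -
      ∫ t in ((k : ℝ) / n)..((k + 1 : ℕ) / n : ℝ), g t‖ ≤ ε / n := by
    intro k hk
    have hk' : (k : ℝ) + 1 ≤ n := by exact_mod_cast Finset.mem_range.1 hk
    have hd : (((k + 1 : ℕ) : ℝ) / n - k / n) = (n : ℝ)⁻¹ := by
      push_cast; field_simp; ring
    have hle : (k : ℝ) / n ≤ ((k + 1 : ℕ) : ℝ) / n := by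
      have := inv_pos.2 hn'
      linarith
    rw [← hd, ← intervalIntegral.integral_const, ← intervalIntegral.integral_sub
      (by simp) (hg.intervalIntegrable _ _)]
    have := intervalIntegral.norm_integral_le_of_norm_le_const (a := (k : ℝ) / n)
      (b := ((k + 1 : ℕ) : ℝ) / n) (C := ε) (f := fun t => g (k / n) - g t) ?_
    · rw [hd, abs_of_pos (inv_pos.2 hn')] at this
      rwa [div_eq_mul_inv]
    · intro t ht
      rw [Set.uIoc_of_le hle] at ht
      have h0 : (0 : ℝ) ≤ k / n := by positivity
      have h1 : ((k + 1 : ℕ) : ℝ) / n ≤ 1 := by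
        rw [div_le_one hn']; exact_mod_cast hk'
      refine h _ ⟨h0, hle.trans h1⟩ _ ⟨h0.trans ht.1.le, ht.2.trans h1⟩ ?_
      rw [abs_sub_comm, abs_of_nonneg (by linarith [ht.1])]
      rw [one_div]
      linarith [ht.2]
  refine (norm_sum_le_of_le _ h2).trans ?_
  rw [Finset.sum_const, Finset.card_range, nsmul_eq_mul]
  exact (mul_div_cancel₀ ε hn'.ne').le

variable {𝕜 : Type*} [RCLike 𝕜] {X : Type*} [NormedAddCommGroup X] [NormedSpace 𝕜 X]

/-- Bounded `τ`-Cauchy sequences converge in `τ`. -/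
theorem AdmissibleTopology.exists_tendsto (τ : AdmissibleTopology 𝕜 X) {u : ℕ → X} {C : ℝ}
    (hC : ∀ n, ‖u n‖ ≤ C)
    (hu : ∀ p : Seminorm 𝕜 X, τ.ContSeminorm p →
      Tendsto (fun mn : ℕ × ℕ => p (u mn.1 - u mn.2)) atTop (𝓝 0)) :
    ∃ y, Tendsto u atTop (@nhds X τ.top y) := by
  have hC0 : 0 ≤ C := (norm_nonneg _).trans (hC 0)
  -- Rescaling by `C + 1` puts the sequence in the unit ball and stays invertible when `C = 0`.
  let c : 𝕜 := ((C + 1 : ℝ) : 𝕜)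
  have hc : c ≠ 0 := by simp only [c, ne_eq, RCLike.ofReal_eq_zero]; linarith
  have hcn : ‖c‖ = C + 1 := by simp only [c, RCLike.norm_ofReal]; exact abs_of_pos (by linarith)
  obtain ⟨y, -, hy⟩ := τ.seqComplete (fun n => c⁻¹ • u n) (fun n => by
      rw [norm_smul, norm_inv, hcn, inv_mul_le_iff₀ (by linarith)]
      linarith [hC n]) (by
      rw [τ.tendsto_zero_iff]
      intro p hp
      have := (hu p hp).const_mul ‖c⁻¹‖
      simpa only [← smul_sub, map_smul_eq_mul, mul_zero] using this)
  refine ⟨c • y, ?_⟩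
  rw [τ.tendsto_iff] at hy ⊢
  intro p hp
  have := (hy p hp).const_mul ‖c‖
  simp only [← map_smul_eq_mul, smul_sub, smul_inv_smul₀ hc, mul_zero] at this
  exact this

end Riemann

/-! ### Weak `τ`-integrals -/

section Integral

variable {𝕜 : Type*} [RCLike 𝕜] {X : Type*} [NormedAddCommGroup X] [NormedSpace 𝕜 X]

/-- `f : ℝ → X` is continuous for `τ`, and so are its compositions with the functionals that are
sequentially `τ`-continuous on norm-bounded sets. -/
structure AdmissibleTopology.ContCurve (τ : AdmissibleTopology 𝕜 X) (f : ℝ → X) : Prop where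
  tendsto : ∀ t, Tendsto f (𝓝 t) (@nhds X τ.top (f t))
  cont : ∀ φ : X →L[𝕜] 𝕜, τ.SeqCont φ → Continuous fun t => φ (f t)

/-- The `τ`-integral of a bounded `τ`-continuous curve over `[0, 1]`. -/
theorem AdmissibleTopology.ContCurve.exists_integral_unit {τ : AdmissibleTopology 𝕜 X} {f : ℝ → X}
    (hf : τ.ContCurve f) {C : ℝ} (hC : ∀ t ∈ Set.Icc (0 : ℝ) 1, ‖f t‖ ≤ C) :
    ∃ y : X, ∀ φ : X →L[𝕜] 𝕜, τ.SeqCont φ → φ y = ∫ t in (0 : ℝ)..1, φ (f t) := by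
  have hC0 : 0 ≤ C := (norm_nonneg _).trans (hC 0 (by simp))
  let u : ℕ → X := fun n => ((((n + 1 : ℕ) : ℝ)⁻¹ : ℝ) : 𝕜) •
    ∑ k ∈ Finset.range (n + 1), f (k / (n + 1 : ℕ))
  have hφu : ∀ (φ : X →L[𝕜] 𝕜) n, φ (u n) =
      ((n + 1 : ℕ) : ℝ)⁻¹ • ∑ k ∈ Finset.range (n + 1), φ (f (k / (n + 1 : ℕ))) := by
    intro φ n
    simp only [u, map_smul, map_sum, RCLike.real_smul_eq_coe_mul, smul_eq_mul]
  have hub : ∀ n, ‖u n‖ ≤ C := by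
    intro n
    have hn : (0 : ℝ) < (n + 1 : ℕ) := by positivity
    have h1 : ‖∑ k ∈ Finset.range (n + 1), f (k / (n + 1 : ℕ))‖ ≤ (n + 1 : ℕ) * C := by
      refine (norm_sum_le_of_le _ (f := fun k : ℕ => f (k / (n + 1 : ℕ))) (n := fun _ => C)
        fun k hk => hC _ ⟨by positivity, ?_⟩).trans (by simp)
      rw [div_le_one hn]
      exact_mod_cast (Finset.mem_range.1 hk).le
    simp only [u, norm_smul, RCLike.norm_ofReal]
    rw [abs_of_pos (inv_pos.2 hn), inv_mul_le_iff₀ hn]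
    exact h1
  -- `N` does not depend on `φ`: the modulus of continuity of `f` for `p` serves every `φ` dominated
  -- by `p`. Duality then makes the Riemann sums Cauchy for `p`.
  have key : ∀ p : Seminorm 𝕜 X, τ.ContSeminorm p → ∀ ε > 0, ∃ N : ℕ, ∀ n ≥ N,
      ∀ φ : X →L[𝕜] 𝕜, τ.SeqCont φ → (∀ z, ‖φ z‖ ≤ p z) →
      ‖φ (u n) - ∫ t in (0 : ℝ)..1, φ (f t)‖ ≤ ε := by
    intro p hp ε hε
    obtain ⟨δ, hδ, h⟩ := exists_delta_of_seminorm_continuous p.toAddGroupSeminorm (f := f)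
      (fun t => τ.tendsto_iff.1 (hf.tendsto t) p hp) hε
    obtain ⟨N, hN⟩ := exists_nat_one_div_lt hδ
    refine ⟨N, fun n hn φ hφ hφp => ?_⟩
    rw [hφu]
    refine norm_riemannSum_sub_integral_le (hf.cont φ hφ) n.succ_pos fun s hs t ht hst => ?_
    rw [← map_sub]
    refine (hφp _).trans (h s hs t ht (hst.trans_lt (lt_of_le_of_lt ?_ hN))).le
    push_cast
    gcongr
  obtain ⟨y, hy⟩ := τ.exists_tendsto hub fun p hp => by
    rw [Metric.tendsto_atTop]
    intro ε hε
    obtain ⟨N, hN⟩ := key p hp (ε / 3) (by positivity)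
    refine ⟨(N, N), fun mn hmn => ?_⟩
    rw [Real.dist_eq, sub_zero, abs_of_nonneg (apply_nonneg _ _)]
    refine lt_of_le_of_lt (hp.dualSeminorm _ (ε / 3 + ε / 3) fun φ hφ hφp => ?_) (by linarith)
    rw [map_sub, ← sub_sub_sub_cancel_right _ _ (∫ t in (0 : ℝ)..1, φ (f t))]
    exact (norm_sub_le _ _).trans (add_le_add (hN _ hmn.1 φ hφ hφp) (hN _ hmn.2 φ hφ hφp))
  refine ⟨y, fun φ hφ => tendsto_nhds_unique (hφ.tendsto hub hy) ?_⟩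
  rw [Metric.tendsto_atTop]
  intro ε hε
  obtain ⟨δ, hδ, h⟩ := exists_delta_of_seminorm_continuous (normAddGroupSeminorm 𝕜)
    (f := fun t => φ (f t))
    (fun t => tendsto_iff_norm_sub_tendsto_zero.1 ((hf.cont φ hφ).tendsto t)) (half_pos hε)
  obtain ⟨N, hN⟩ := exists_nat_one_div_lt hδ
  refine ⟨N, fun n hn => ?_⟩
  rw [hφu, dist_eq_norm]
  refine lt_of_le_of_lt (norm_riemannSum_sub_integral_le (ε := ε / 2) (hf.cont φ hφ) n.succ_pos
    fun s hs t ht hst => ?_) (half_lt_self hε)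
  refine (h s hs t ht (hst.trans_lt (lt_of_le_of_lt ?_ hN))).le
  push_cast
  gcongr

theorem AdmissibleTopology.ContCurve.comp_add {τ : AdmissibleTopology 𝕜 X} {f : ℝ → X}
    (hf : τ.ContCurve f) (c : ℝ) : τ.ContCurve fun t => f (t + c) where
  tendsto t := (hf.tendsto (t + c)).comp ((continuous_add_const c).tendsto t)
  cont φ hφ := (hf.cont φ hφ).comp (continuous_add_const c)

theorem AdmissibleTopology.ContCurve.integrableOn {τ : AdmissibleTopology 𝕜 X} {f : ℝ → X}
    (hf : τ.ContCurve f) {M a : ℝ} (ha : 0 < a) (hM : ∀ t, 0 ≤ t → ‖f t‖ ≤ M * Real.exp (-a * t))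
    {φ : X →L[𝕜] 𝕜} (hφ : τ.SeqCont φ) :
    MeasureTheory.IntegrableOn (fun t => φ (f t)) (Set.Ioi 0) := by
  refine MeasureTheory.Integrable.mono'
    ((exp_neg_integrableOn_Ioi 0 ha).const_mul (‖φ‖ * M))
    (hf.cont φ hφ).aestronglyMeasurable ?_
  filter_upwards [MeasureTheory.ae_restrict_mem measurableSet_Ioi] with t ht
  rw [mul_assoc]
  exact φ.le_opNorm_of_le (hM t (le_of_lt ht))

/-- The `τ`-integral of an exponentially decaying `τ`-continuous curve over `(0, ∞)`. -/
theorem AdmissibleTopology.ContCurve.exists_integral_Ioi [CompleteSpace X]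
    {τ : AdmissibleTopology 𝕜 X} {f : ℝ → X}
    (hf : τ.ContCurve f) {M a : ℝ} (ha : 0 < a)
    (hM : ∀ t, 0 ≤ t → ‖f t‖ ≤ M * Real.exp (-a * t)) :
    ∃ y : X, ∀ φ : X →L[𝕜] 𝕜, τ.SeqCont φ → φ y = ∫ t in Set.Ioi (0 : ℝ), φ (f t) := by
  have hM0 : 0 ≤ M := by simpa using (norm_nonneg _).trans (hM 0 le_rfl)
  have hb : ∀ (k : ℕ), ∀ t, 0 ≤ t → ‖f (t + k)‖ ≤ M * Real.exp (-a * k) := by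
    intro k t ht
    refine (hM _ (by positivity)).trans ?_
    have : -a * (t + k) ≤ -a * k := by nlinarith
    gcongr
  -- `y k` is the integral over `[k, k + 1]`. Its norm decays geometrically, so the series converges
  -- in norm.
  choose y hy using fun k : ℕ => (hf.comp_add k).exists_integral_unit fun t ht => hb k t ht.1
  have hyn : ∀ k, ‖y k‖ ≤ M * Real.exp (-a * k) := by
    intro k
    refine τ.dualSeminorm_norm (y k) _ fun φ hφ hφn => ?_
    rw [hy k φ hφ]
    refine (intervalIntegral.norm_integral_le_of_norm_le_const (C := M * Real.exp (-a * k))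
      fun t ht => ?_).trans (by simp)
    rw [Set.uIoc_of_le zero_le_one] at ht
    exact (hφn _).trans (hb k t ht.1.le)
  have hs : Summable y := by
    refine Summable.of_norm_bounded (g := fun k : ℕ => M * Real.exp (-a * k)) ?_ hyn
    refine Summable.mul_left M ?_
    have := Real.summable_exp_nat_mul_iff.2 (neg_lt_zero.2 ha)
    simpa only [mul_comm] using this
  refine ⟨∑' k, y k, fun φ hφ => ?_⟩
  have h1 := ((φ.hasSum hs.hasSum).tendsto_sum_nat)
  refine tendsto_nhds_unique h1 ?_
  have h2 := MeasureTheory.intervalIntegral_tendsto_integral_Ioi 0 (hf.integrableOn ha hM hφ)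
    (tendsto_natCast_atTop_atTop (R := ℝ))
  refine h2.congr fun n => ?_
  have h3 := intervalIntegral.sum_integral_adjacent_intervals (f := fun t => φ (f t))
    (μ := MeasureTheory.volume) (a := fun k : ℕ => (k : ℝ)) (n := n)
    fun k _ => (hf.cont φ hφ).intervalIntegrable _ _
  rw [Nat.cast_zero] at h3
  rw [← h3]
  refine Finset.sum_congr rfl fun k _ => ?_
  rw [hy k φ hφ, intervalIntegral.integral_comp_add_right (fun t => φ (f t))]
  simp [add_comm]

end Integral

/-! ### Orbits and stability of the functionals -/

section Orbit

variable {𝕜 : Type*} [RCLike 𝕜] {X : Type*} [NormedAddCommGroup X] [NormedSpace 𝕜 X]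
  {τ : AdmissibleTopology 𝕜 X} {T : ℝ≥0 → X →L[𝕜] X}

/-- Local bi-equicontinuity at the single time `h` gives `T h (u n) → 0`; this stability is what the
class `SeqCont` is chosen for. -/
theorem IsBicontinuousSemigroup.seqCont_comp (hT : IsBicontinuousSemigroup τ T)
    {φ : X →L[𝕜] 𝕜} (hφ : τ.SeqCont φ) (h : ℝ≥0) : τ.SeqCont (φ.comp (T h)) := by
  rintro u ⟨C, hC⟩ hu
  refine hφ (fun n => T h (u n)) ⟨‖T h‖ * C, fun n => (T h).le_opNorm_of_le (hC n)⟩ ?_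
  intro U hU
  exact (hT.locBiequicont u ⟨C, hC⟩ hu h U hU).mono fun n hn => hn h le_rfl

theorem HasNegativeGrowthBound.exists_norm_le (hneg : HasNegativeGrowthBound T) :
    ∃ M : ℝ, 1 ≤ M ∧ ∀ t, ‖T t‖ ≤ M := by
  obtain ⟨M, ω, hM, hω, h⟩ := hneg
  refine ⟨M, hM, fun t => (h t).trans ?_⟩
  have : Real.exp (ω * t) ≤ 1 := Real.exp_le_one_iff.2 (mul_nonpos_of_nonpos_of_nonneg hω.le t.2)
  nlinarith

/-- Orbits, extended by `x` to negative times. -/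
theorem IsBicontinuousSemigroup.contCurve_orbit (hT : IsBicontinuousSemigroup τ T) {M : ℝ}
    (hM : ∀ t, ‖T t‖ ≤ M) (x : X) : τ.ContCurve fun t => T t.toNNReal x where
  tendsto t := by
    have h : Tendsto (fun s => T s x) (𝓝 t.toNNReal) (@nhds X τ.top (T t.toNNReal x)) :=
      @Continuous.tendsto _ _ _ τ.top _ (hT.strongCont x) _
    exact h.comp (continuous_real_toNNReal.tendsto t)
  cont φ hφ := by
    have : Continuous fun t : ℝ≥0 => φ (T t x) := by
      refine continuous_iff_seqContinuous.2 fun u t hu => ?_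
      have h : Tendsto (fun s => T s x) (𝓝 t) (@nhds X τ.top (T t x)) :=
        @Continuous.tendsto _ _ _ τ.top _ (hT.strongCont x) _
      exact hφ.tendsto (fun n => (T (u n)).le_of_opNorm_le (hM _) x) (h.comp hu)
    exact this.comp continuous_real_toNNReal

end Orbit

/-! ### The Laplace transform of the semigroup -/

section Laplace

variable {𝕜 : Type*} [RCLike 𝕜] {X : Type*} [NormedAddCommGroup X] [NormedSpace 𝕜 X]
  {τ : AdmissibleTopology 𝕜 X} {T : ℝ≥0 → X →L[𝕜] X}

theorem AdmissibleTopology.tendsto_smul (τ : AdmissibleTopology 𝕜 X) {ι : Type*} {l : Filter ι}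
    {c : ι → 𝕜} {u : ι → X} {c₀ : 𝕜} {y : X} (hc : Tendsto c l (𝓝 c₀))
    (hu : Tendsto u l (@nhds X τ.top y)) : Tendsto (fun i => c i • u i) l (@nhds X τ.top (c₀ • y)) := by
  have := @WithSeminorms.continuousSMul _ _ _ _ _ _ τ.top _ τ.locallyConvex.withSeminorms'
  let := τ.top
  exact hc.smul hu

theorem AdmissibleTopology.tendsto_add (τ : AdmissibleTopology 𝕜 X) {ι : Type*} {l : Filter ι}
    {u v : ι → X} {x y : X} (hu : Tendsto u l (@nhds X τ.top x))
    (hv : Tendsto v l (@nhds X τ.top y)) : Tendsto (fun i => u i + v i) l (@nhds X τ.top (x + y)) := by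
  have := @WithSeminorms.topologicalAddGroup _ _ _ _ _ _ τ.top _ τ.locallyConvex.withSeminorms'
  let := τ.top
  exact hu.add hv

theorem AdmissibleTopology.tendsto_const (τ : AdmissibleTopology 𝕜 X) {ι : Type*} {l : Filter ι}
    (x : X) : Tendsto (fun _ : ι => x) l (@nhds X τ.top x) := by
  let := τ.top
  exact tendsto_const_nhds

theorem AdmissibleTopology.ContCurve.smul {f : ℝ → X} (hf : τ.ContCurve f) {c : ℝ → 𝕜}
    (hc : Continuous c) : τ.ContCurve fun t => c t • f t where
  tendsto t := τ.tendsto_smul (hc.tendsto t) (hf.tendsto t)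
  cont φ hφ := by
    simp only [map_smul, smul_eq_mul]
    exact hc.mul (hf.cont φ hφ)

/-- For a countably generated filter sequences suffice; dropping finitely many terms makes the bound
hold throughout. -/
theorem AdmissibleTopology.SeqCont.tendsto_of_eventually {φ : X →L[𝕜] 𝕜} (hφ : τ.SeqCont φ)
    {ι : Type*} {l : Filter ι} [l.IsCountablyGenerated] {u : ι → X} {y : X} {C : ℝ}
    (hC : ∀ᶠ i in l, ‖u i‖ ≤ C) (hu : Tendsto u l (@nhds X τ.top y)) :
    Tendsto (fun i => φ (u i)) l (𝓝 (φ y)) := by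
  refine tendsto_of_seq_tendsto fun s hs => ?_
  obtain ⟨N, hN⟩ := eventually_atTop.1 (hs.eventually hC)
  refine (tendsto_add_atTop_iff_nat N).1 ?_
  exact hφ.tendsto (fun n => hN (n + N) (Nat.le_add_left _ _))
    (hu.comp (hs.comp (tendsto_add_atTop_nat N)))

/-- `R` is the Laplace transform of `T` at `l`, in the sense of the `τ`-integral. -/
def IsLaplace (τ : AdmissibleTopology 𝕜 X) (T : ℝ≥0 → X →L[𝕜] X) (l : ℝ) (R : X →L[𝕜] X) : Prop :=
  ∀ φ : X →L[𝕜] 𝕜, τ.SeqCont φ → ∀ x,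
    φ (R x) = ∫ t in Set.Ioi (0 : ℝ), ((Real.exp (-l * t) : ℝ) : 𝕜) * φ (T t.toNNReal x)

theorem continuous_ofReal_exp (l : ℝ) : Continuous fun t : ℝ => ((Real.exp (-l * t) : ℝ) : 𝕜) :=
  RCLike.continuous_ofReal.comp (Real.continuous_exp.comp (continuous_const.mul continuous_id))

theorem norm_ofReal_exp (t : ℝ) : ‖((Real.exp t : ℝ) : 𝕜)‖ = Real.exp t := by
  rw [RCLike.norm_ofReal, Real.abs_exp]

theorem norm_exp_smul_orbit_le {M : ℝ} (hM : ∀ t, ‖T t‖ ≤ M) (l : ℝ) (x : X) (t : ℝ) :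
    ‖((Real.exp (-l * t) : ℝ) : 𝕜) • T t.toNNReal x‖ ≤ M * ‖x‖ * Real.exp (-l * t) := by
  rw [norm_smul, norm_ofReal_exp, mul_comm]
  gcongr
  exact (T _).le_of_opNorm_le (hM _) x

theorem IsBicontinuousSemigroup.integrableOn_laplace (hT : IsBicontinuousSemigroup τ T) {M : ℝ}
    (hM : ∀ t, ‖T t‖ ≤ M) {l : ℝ} (hl : 0 < l) {φ : X →L[𝕜] 𝕜} (hφ : τ.SeqCont φ) (x : X) :
    MeasureTheory.IntegrableOn
      (fun t : ℝ => ((Real.exp (-l * t) : ℝ) : 𝕜) * φ (T t.toNNReal x)) (Set.Ioi 0) := by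
  have := ((hT.contCurve_orbit hM x).smul (continuous_ofReal_exp (𝕜 := 𝕜) l)).integrableOn hl
    (fun t _ => norm_exp_smul_orbit_le hM l x t) hφ
  simpa only [map_smul, smul_eq_mul] using this

theorem IsBicontinuousSemigroup.exists_isLaplace [CompleteSpace X]
    (hT : IsBicontinuousSemigroup τ T) {M : ℝ}
    (hM : ∀ t, ‖T t‖ ≤ M) {l : ℝ} (hl : 0 < l) : ∃ R, IsLaplace τ T l R := by
  have hM0 : 0 ≤ M := (norm_nonneg _).trans (hM 0)
  choose R hR using fun x =>
    ((hT.contCurve_orbit hM x).smul (continuous_ofReal_exp (𝕜 := 𝕜) l)).exists_integral_Ioi hl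
      (fun t _ => norm_exp_smul_orbit_le hM l x t)
  simp only [map_smul, smul_eq_mul] at hR
  -- The weak integrals are unique since `SeqCont` separates points, so linearity can be tested on
  -- functionals.
  let R' : X →ₗ[𝕜] X :=
    { toFun := R
      map_add' := fun x y => τ.ext_seqCont fun φ hφ => by
        rw [_root_.map_add, hR _ φ hφ, hR _ φ hφ, hR _ φ hφ, ← MeasureTheory.integral_add
          (hT.integrableOn_laplace hM hl hφ x) (hT.integrableOn_laplace hM hl hφ y)]
        simp only [_root_.map_add, mul_add]
      map_smul' := fun c x => τ.ext_seqCont fun φ hφ => by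
        rw [map_smul, hR _ φ hφ, hR _ φ hφ, smul_eq_mul, RingHom.id_apply,
          ← MeasureTheory.integral_const_mul]
        simp only [map_smul, smul_eq_mul, mul_left_comm] }
  refine ⟨R'.mkContinuous (M * l⁻¹) fun x => ?_, fun φ hφ x => hR x φ hφ⟩
  refine τ.dualSeminorm_norm _ _ fun φ hφ hφn => ?_
  change ‖φ (R x)‖ ≤ _
  rw [hR x φ hφ]
  refine (MeasureTheory.norm_integral_le_of_norm_le
    ((exp_neg_integrableOn_Ioi 0 hl).const_mul (M * ‖x‖)) (MeasureTheory.ae_of_all _ fun t => ?_)).trans ?_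
  · rw [← smul_eq_mul, ← map_smul]
    exact (hφn _).trans (norm_exp_smul_orbit_le hM l x t)
  · rw [MeasureTheory.integral_const_mul, integral_exp_mul_Ioi (neg_lt_zero.2 hl)]
    simp only [mul_zero, Real.exp_zero, neg_div_neg_eq, one_div]
    linarith

/-- Using the Laplace formula for `φ ∘ T(h)` and shifting time by `h`, `exp(-l h) T(h) R x` becomes
the tail integral over `(h, ∞)`. -/
theorem IsLaplace.apply_semigroup (hT : IsBicontinuousSemigroup τ T) {M : ℝ}
    (hM : ∀ t, ‖T t‖ ≤ M) {l : ℝ} (hl : 0 < l) {R : X →L[𝕜] X} (hR : IsLaplace τ T l R)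
    {φ : X →L[𝕜] 𝕜} (hφ : τ.SeqCont φ) (h : ℝ≥0) (x : X) :
    φ (((Real.exp (-l * h) : ℝ) : 𝕜) • T h (R x) - R x) =
      - ∫ s in (0 : ℝ)..h, ((Real.exp (-l * s) : ℝ) : 𝕜) * φ (T s.toNNReal x) := by
  let g : ℝ → 𝕜 := fun s => ((Real.exp (-l * s) : ℝ) : 𝕜) * φ (T s.toNNReal x)
  have hg : MeasureTheory.IntegrableOn g (Set.Ioi 0) := hT.integrableOn_laplace hM hl hφ x
  have h1 : ((Real.exp (-l * h) : ℝ) : 𝕜) * φ (T h (R x)) = ∫ s in Set.Ioi (h : ℝ), g s := by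
    have e1 := hR (φ.comp (T h)) (hT.seqCont_comp hφ h) x
    rw [ContinuousLinearMap.comp_apply] at e1
    have e2 := (MeasureTheory.measurePreserving_add_right MeasureTheory.volume (h : ℝ)).setIntegral_preimage_emb
      (measurableEmbedding_addRight (h : ℝ)) g (Set.Ioi (h : ℝ))
    simp only [Set.preimage_add_const_Ioi, sub_self] at e2
    rw [e1, ← e2, ← MeasureTheory.integral_const_mul]
    refine MeasureTheory.setIntegral_congr_fun measurableSet_Ioi fun t ht => ?_
    simp only [g, ContinuousLinearMap.comp_apply]
    rw [← mul_assoc, ← RCLike.ofReal_mul, ← Real.exp_add,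
      Real.toNNReal_add (Set.mem_Ioi.1 ht).le (NNReal.coe_nonneg h), Real.toNNReal_coe, add_comm t.toNNReal, hT.map_add]
    simp only [ContinuousLinearMap.comp_apply]
    congr 4
    ring
  have h2 := intervalIntegral.integral_interval_add_Ioi (a := 0) (b := (h : ℝ)) hg
    (hg.mono_set (Set.Ioi_subset_Ioi h.2))
  rw [map_sub, map_smul, smul_eq_mul, h1, hR φ hφ x]
  change _ - ∫ s in Set.Ioi 0, g s = - ∫ s in (0 : ℝ)..h, g s
  rw [← h2]
  ring

end Laplace

/-! ### The Laplace transform is the resolvent of the generator -/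

section Generator

variable {𝕜 : Type*} [RCLike 𝕜] {X : Type*} [NormedAddCommGroup X] [NormedSpace 𝕜 X]
  {τ : AdmissibleTopology 𝕜 X} {T : ℝ≥0 → X →L[𝕜] X}

/-- By `IsLaplace.apply_semigroup`, the vector estimated is minus the mean over `[0, h]` of `exp(-l
s) T(s)x - x`. -/
theorem IsLaplace.seminorm_average_le (hT : IsBicontinuousSemigroup τ T) {M : ℝ}
    (hM : ∀ t, ‖T t‖ ≤ M) {l : ℝ} (hl : 0 < l) {R : X →L[𝕜] X} (hR : IsLaplace τ T l R)
    {q : Seminorm 𝕜 X} (hq : τ.DualSeminorm q) {h : ℝ≥0} (hh : 0 < h) (x : X) {B : ℝ}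
    (hB : ∀ s : ℝ, 0 < s → s ≤ h →
      q (((Real.exp (-l * s) : ℝ) : 𝕜) • T s.toNNReal x - x) ≤ B) :
    q ((((h : ℝ) : 𝕜))⁻¹ • (((Real.exp (-l * h) : ℝ) : 𝕜) • T h (R x) - R x) + x) ≤ B := by
  have hh' : (0 : ℝ) < h := hh
  have hk : (((h : ℝ) : 𝕜)) ≠ 0 := by simpa using hh.ne'
  refine hq _ _ fun φ hφ hφq => ?_
  have hc : Continuous fun s : ℝ => ((Real.exp (-l * s) : ℝ) : 𝕜) * φ (T s.toNNReal x) :=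
    (continuous_ofReal_exp l).mul ((hT.contCurve_orbit hM x).cont φ hφ)
  have h1 : φ ((((h : ℝ) : 𝕜))⁻¹ • (((Real.exp (-l * h) : ℝ) : 𝕜) • T h (R x) - R x) + x) =
      -((((h : ℝ) : 𝕜))⁻¹ * ∫ s in (0 : ℝ)..h,
        (((Real.exp (-l * s) : ℝ) : 𝕜) * φ (T s.toNNReal x) - φ x)) := by
    rw [intervalIntegral.integral_sub (hc.intervalIntegrable _ _) (by simp),
      intervalIntegral.integral_const, map_add, map_smul, hR.apply_semigroup hT hM hl hφ,
      sub_zero, RCLike.real_smul_eq_coe_mul, smul_eq_mul, mul_sub, inv_mul_cancel_left₀ hk]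
    ring
  rw [h1, norm_neg, norm_mul, norm_inv, RCLike.norm_ofReal, abs_of_pos hh',
    inv_mul_le_iff₀ hh', mul_comm]
  have h2 := intervalIntegral.norm_integral_le_of_norm_le_const (a := 0) (b := (h : ℝ)) (C := B)
    (f := fun s : ℝ => ((Real.exp (-l * s) : ℝ) : 𝕜) * φ (T s.toNNReal x) - φ x) fun s hs => by
      rw [Set.uIoc_of_le hh'.le] at hs
      rw [← smul_eq_mul, ← map_smul, ← map_sub]
      exact (hφq _).trans (hB s hs.1 hs.2)
  rwa [sub_zero, abs_of_pos hh'] at h2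

/-- Passes from the rescaled semigroup `exp(-l h) T(h)`, where the mean value estimate applies, to
`T` itself. As `h ↓ 0` the second summand tends to `l y - x`. -/
theorem semigroup_sub_eq_smul_add (l : ℝ) {h : ℝ≥0} (y x : X) :
    (((h : ℝ) : 𝕜))⁻¹ • (T h y - y) = ((Real.exp (l * h) : ℝ) : 𝕜) •
      (((((h : ℝ) : 𝕜))⁻¹ • (((Real.exp (-l * h) : ℝ) : 𝕜) • T h y - y) + x) +
        ((((h : ℝ)⁻¹ * (1 - Real.exp (-l * h)) : ℝ) : 𝕜) • y + -x)) := by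
  have h1 : ((Real.exp (l * h) : ℝ) : 𝕜) * ((Real.exp (-l * h) : ℝ) : 𝕜) = 1 := by
    rw [← RCLike.ofReal_mul, ← Real.exp_add]
    simp
  rw [RCLike.ofReal_mul, RCLike.ofReal_sub, RCLike.ofReal_one, RCLike.ofReal_inv]
  match_scalars
  · linear_combination -((((h : ℝ) : 𝕜))⁻¹) * h1
  · linear_combination ((((h : ℝ) : 𝕜))⁻¹) * h1
  · ring

theorem tendsto_coe_nhdsGT_zero : Tendsto (fun h : ℝ≥0 => (h : ℝ)) (𝓝[>] 0) (𝓝[>] 0) := by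
  refine tendsto_nhdsWithin_of_tendsto_nhds_of_eventually_within _
    ((NNReal.continuous_coe.tendsto 0).mono_left nhdsWithin_le_nhds) ?_
  filter_upwards [self_mem_nhdsWithin] with h hh
  exact hh

theorem tendsto_inv_mul_one_sub_exp (l : ℝ) :
    Tendsto (fun h : ℝ≥0 => (h : ℝ)⁻¹ * (1 - Real.exp (-l * h))) (𝓝[>] 0) (𝓝 l) := by
  have h1 : HasDerivAt (fun t : ℝ => 1 - Real.exp (-l * t)) l 0 := by
    have := (((hasDerivAt_id (0 : ℝ)).const_mul (-l)).exp).const_sub 1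
    simpa using this
  have h2 := h1.tendsto_slope_zero_right
  simpa [Function.comp_def] using h2.comp tendsto_coe_nhdsGT_zero

/-- The Laplace transform at `l` maps into the domain of the generator. -/
theorem IsLaplace.mem_generatorGraph (hT : IsBicontinuousSemigroup τ T) {M : ℝ}
    (hM : ∀ t, ‖T t‖ ≤ M) {l : ℝ} (hl : 0 < l) {R : X →L[𝕜] X} (hR : IsLaplace τ T l R) (x : X) :
    (R x, (l : 𝕜) • R x - x) ∈ generatorGraph τ T := by
  have hM0 : 0 ≤ M := (norm_nonneg _).trans (hM 0)
  have hcurve := (hT.contCurve_orbit hM x).smul (continuous_ofReal_exp (𝕜 := 𝕜) l)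
  refine ⟨?_, Real.exp l * ((M * ‖x‖ + ‖x‖) + (l * ‖R x‖ + ‖x‖)), fun h hh hh1 => ?_⟩
  · simp only [semigroup_sub_eq_smul_add (T := T) l (R x) x]
    have h1 : Tendsto (fun h : ℝ≥0 => (((h : ℝ) : 𝕜))⁻¹ •
        (((Real.exp (-l * h) : ℝ) : 𝕜) • T h (R x) - R x) + x) (𝓝[>] 0) (@nhds X τ.top 0) := by
      rw [τ.tendsto_zero_iff]
      intro p hp
      rw [Metric.tendsto_nhds]
      intro ε hε
      have h0 := τ.tendsto_iff.1 (hcurve.tendsto 0) p hp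
      simp only [mul_zero, Real.exp_zero, RCLike.ofReal_one, Real.toNNReal_zero, hT.map_zero,
        ContinuousLinearMap.id_apply, one_smul] at h0
      obtain ⟨δ, hδ, h0⟩ := Metric.eventually_nhds_iff.1 (h0.eventually (gt_mem_nhds (half_pos hε)))
      have hev : ∀ᶠ h : ℝ≥0 in 𝓝[>] 0, (h : ℝ) < δ :=
        ((NNReal.continuous_coe.tendsto 0).mono_left nhdsWithin_le_nhds).eventually
          (gt_mem_nhds (by simpa using hδ))
      filter_upwards [hev, self_mem_nhdsWithin] with h hhδ hh
      rw [Real.dist_eq, sub_zero, abs_of_nonneg (apply_nonneg _ _)]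
      refine lt_of_le_of_lt (hR.seminorm_average_le hT hM hl hp.dualSeminorm hh x
        fun s hs hsh => ?_) (half_lt_self hε)
      refine (h0 ?_).le
      rw [Real.dist_eq, sub_zero, abs_of_pos hs]
      exact hsh.trans_lt hhδ
    have h2 : Tendsto (fun h : ℝ≥0 => ((((h : ℝ)⁻¹ * (1 - Real.exp (-l * h)) : ℝ) : 𝕜))) (𝓝[>] 0)
        (𝓝 (l : 𝕜)) :=
      (RCLike.continuous_ofReal.tendsto l).comp (tendsto_inv_mul_one_sub_exp l)
    have h3 : Tendsto (fun h : ℝ≥0 => ((Real.exp (l * h) : ℝ) : 𝕜)) (𝓝[>] 0) (𝓝 1) := by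
      have hc : Continuous fun h : ℝ≥0 => ((Real.exp (l * h) : ℝ) : 𝕜) :=
        RCLike.continuous_ofReal.comp
          (Real.continuous_exp.comp (continuous_const.mul NNReal.continuous_coe))
      have := (hc.tendsto 0).mono_left (nhdsWithin_le_nhds (s := Set.Ioi 0))
      simpa using this
    have := τ.tendsto_smul h3 (τ.tendsto_add h1 (τ.tendsto_add
      (τ.tendsto_smul h2 (τ.tendsto_const (R x))) (τ.tendsto_const (-x))))
    rw [zero_add, one_smul, ← sub_eq_add_neg] at this
    exact this
  · have hh' : (0 : ℝ) < h := hh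
    have hh1' : (h : ℝ) ≤ 1 := hh1
    have e1 : ‖T h (R x) - R x‖ / (h : ℝ) = ‖(((h : ℝ) : 𝕜))⁻¹ • (T h (R x) - R x)‖ := by
      rw [norm_smul, norm_inv, RCLike.norm_ofReal, abs_of_pos hh', div_eq_inv_mul]
    rw [e1, semigroup_sub_eq_smul_add l (R x) x, norm_smul, norm_ofReal_exp]
    have e2 : Real.exp (l * h) ≤ Real.exp l := Real.exp_le_exp.2 (by nlinarith)
    refine mul_le_mul e2 ?_ (norm_nonneg _) (Real.exp_pos _).le
    refine (norm_add_le _ _).trans (add_le_add ?_ ((norm_add_le _ _).trans (add_le_add ?_ ?_)))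
    · refine hR.seminorm_average_le hT hM hl τ.dualSeminorm_norm hh x fun s hs _ => ?_
      refine (norm_sub_le _ _).trans (add_le_add ?_ le_rfl)
      refine (norm_exp_smul_orbit_le hM l x s).trans (mul_le_of_le_one_right (by positivity) ?_)
      exact Real.exp_le_one_iff.2 (by nlinarith)
    · rw [norm_smul, RCLike.norm_ofReal]
      gcongr
      have e3 : Real.exp (-l * h) ≤ 1 := Real.exp_le_one_iff.2 (by nlinarith)
      have e4 := Real.add_one_le_exp (-l * h)
      rw [abs_of_nonneg (mul_nonneg (inv_pos.2 hh').le (by linarith)), inv_mul_le_iff₀ hh']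
      linarith
    · rw [norm_neg]

/-- The norm bound in the definition of the generator is what allows functionals that are only
sequentially continuous on bounded sets. -/
theorem tendsto_apply_of_mem_generatorGraph {z w : X} (hz : (z, w) ∈ generatorGraph τ T)
    {ψ : X →L[𝕜] 𝕜} (hψ : τ.SeqCont ψ) :
    Tendsto (fun h : ℝ≥0 => ψ ((((h : ℝ) : 𝕜))⁻¹ • (T h z - z))) (𝓝[>] 0) (𝓝 (ψ w)) := by
  obtain ⟨h1, C, hC⟩ := hz
  refine hψ.tendsto_of_eventually (C := C) ?_ h1
  have : ∀ᶠ h : ℝ≥0 in 𝓝[>] 0, h ≤ 1 :=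
    Filter.Eventually.filter_mono nhdsWithin_le_nhds (ge_mem_nhds zero_lt_one)
  filter_upwards [this, self_mem_nhdsWithin] with h hh1 hh
  have hh' : (0 : ℝ) < h := hh
  have := hC h hh hh1
  rwa [norm_smul, norm_inv, RCLike.norm_ofReal, abs_of_pos hh', ← div_eq_inv_mul]

/-- The right difference quotient at `t` is the one at `0` seen through `φ ∘ T(t)`, again in
`SeqCont`. Right derivatives suffice for the fundamental theorem of calculus. -/
theorem hasDerivWithinAt_orbit (hT : IsBicontinuousSemigroup τ T) {z w : X}
    (hz : (z, w) ∈ generatorGraph τ T) {φ : X →L[𝕜] 𝕜} (hφ : τ.SeqCont φ) {t : ℝ} (ht : 0 ≤ t) :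
    HasDerivWithinAt (fun s : ℝ => φ (T s.toNNReal z)) (φ (T t.toNNReal w)) (Set.Ioi t) t := by
  rw [hasDerivWithinAt_iff_tendsto_slope' (by simp)]
  have h1 := tendsto_apply_of_mem_generatorGraph hz (hT.seqCont_comp hφ t.toNNReal)
  have h2 : Tendsto (fun s : ℝ => (s - t).toNNReal) (𝓝[>] t) (𝓝[>] 0) := by
    refine tendsto_nhdsWithin_of_tendsto_nhds_of_eventually_within _ ?_ ?_
    · have : Continuous fun s : ℝ => (s - t).toNNReal :=
        continuous_real_toNNReal.comp (continuous_sub_right t)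
      have := (this.tendsto t).mono_left (nhdsWithin_le_nhds (s := Set.Ioi t))
      simpa using this
    · filter_upwards [self_mem_nhdsWithin] with s hs
      exact Real.toNNReal_pos.2 (sub_pos.2 hs)
  refine (h1.comp h2).congr' ?_
  filter_upwards [self_mem_nhdsWithin] with s hs
  have hst : 0 ≤ s - t := (sub_pos.2 hs).le
  have e : s.toNNReal = t.toNNReal + (s - t).toNNReal := by
    rw [← Real.toNNReal_add ht hst]
    congr 1
    ring
  simp only [Function.comp_apply, ContinuousLinearMap.comp_apply, slope_def_module, map_smul,
    map_sub, Real.coe_toNNReal _ hst, e, hT.map_add, RCLike.real_smul_eq_coe_mul, smul_eq_mul,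
    RCLike.ofReal_inv]

/-- The fundamental theorem of calculus for orbits in the domain of the generator. -/
theorem apply_semigroup_sub_eq_integral (hT : IsBicontinuousSemigroup τ T) {M : ℝ}
    (hM : ∀ t, ‖T t‖ ≤ M) {z w : X}
    (hz : (z, w) ∈ generatorGraph τ T) {φ : X →L[𝕜] 𝕜} (hφ : τ.SeqCont φ) (t : ℝ≥0) :
    φ (T t z - z) = ∫ s in (0 : ℝ)..t, φ (T s.toNNReal w) := by
  rw [intervalIntegral.integral_eq_sub_of_hasDeriv_right_of_le (f := fun s => φ (T s.toNNReal z))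
    (f' := fun s => φ (T s.toNNReal w)) (NNReal.coe_nonneg t) ((hT.contCurve_orbit hM z).cont φ hφ).continuousOn
    (fun s hs => hasDerivWithinAt_orbit hT hz hφ hs.1.le)
    (((hT.contCurve_orbit hM w).cont φ hφ).intervalIntegrable _ _)]
  simp [hT.map_zero]

/-- The Laplace transform is a left inverse of `l - A`. -/
theorem IsLaplace.apply_sub_of_mem_generatorGraph (hT : IsBicontinuousSemigroup τ T) {M : ℝ}
    (hM : ∀ t, ‖T t‖ ≤ M) {l : ℝ} (hl : 0 < l) {R : X →L[𝕜] X} (hR : IsLaplace τ T l R) {z w : X}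
    (hz : (z, w) ∈ generatorGraph τ T) : R ((l : 𝕜) • z - w) = z := by
  refine τ.ext_seqCont fun φ hφ => ?_
  rw [hR φ hφ]
  have h1 := MeasureTheory.intervalIntegral_tendsto_integral_Ioi 0
    (hT.integrableOn_laplace hM hl hφ ((l : 𝕜) • z - w)) tendsto_id
  refine tendsto_nhds_unique h1 ?_
  -- The integrand is the right derivative of `-exp(-l s) φ(T(s)z)`.
  have h2 : ∀ b : ℝ, 0 ≤ b → ∫ t in (0 : ℝ)..b, ((Real.exp (-l * t) : ℝ) : 𝕜) *
      φ (T t.toNNReal ((l : 𝕜) • z - w)) =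
      φ z - ((Real.exp (-l * b) : ℝ) : 𝕜) * φ (T b.toNNReal z) := by
    intro b hb
    rw [intervalIntegral.integral_eq_sub_of_hasDeriv_right_of_le
      (f := fun s : ℝ => -(((Real.exp (-l * s) : ℝ) : 𝕜) * φ (T s.toNNReal z)))
      (f' := fun s : ℝ => ((Real.exp (-l * s) : ℝ) : 𝕜) * φ (T s.toNNReal ((l : 𝕜) • z - w))) hb
      ((continuous_ofReal_exp l).mul ((hT.contCurve_orbit hM z).cont φ hφ)).neg.continuousOn
      (fun s hs => ?_)
      (((continuous_ofReal_exp l).mul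
        ((hT.contCurve_orbit hM _).cont φ hφ)).intervalIntegrable _ _)]
    · simp [hT.map_zero]
      ring
    · have d1 : HasDerivAt (fun s : ℝ => Real.exp (-l * s)) (Real.exp (-l * s) * -l) s := by
        simpa using ((hasDerivAt_id s).const_mul (-l)).exp
      have d2 := ((RCLike.ofRealCLM (K := 𝕜)).hasFDerivAt (x := Real.exp (-l * s))).comp_hasDerivAt s d1
      have d3 : HasDerivWithinAt (fun s : ℝ => ((Real.exp (-l * s) : ℝ) : 𝕜))
          ((Real.exp (-l * s) * -l : ℝ) : 𝕜) (Set.Ioi s) s := d2.hasDerivWithinAt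
      refine (d3.mul (hasDerivWithinAt_orbit hT hz hφ hs.1.le)).neg.congr_deriv ?_
      simp only [map_sub, map_smul, smul_eq_mul, RCLike.ofReal_mul, RCLike.ofReal_neg]
      ring
  have h3 : Tendsto (fun b : ℝ => ((Real.exp (-l * b) : ℝ) : 𝕜) * φ (T b.toNNReal z)) atTop (𝓝 0) := by
    have h4 : Tendsto (fun b : ℝ => ‖φ‖ * (M * ‖z‖) * Real.exp (-l * b)) atTop (𝓝 0) := by
      have := (Real.tendsto_exp_atBot.comp
        (tendsto_id.const_mul_atTop_of_neg (neg_lt_zero.2 hl))).const_mul (‖φ‖ * (M * ‖z‖))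
      simpa using this
    refine squeeze_zero_norm (fun b => ?_) h4
    rw [← smul_eq_mul, ← map_smul, mul_assoc]
    exact φ.le_opNorm_of_le (norm_exp_smul_orbit_le hM l z b)
  have h5 := h3.const_sub (φ z)
  rw [sub_zero] at h5
  refine h5.congr' ?_
  filter_upwards [eventually_ge_atTop 0] with b hb
  exact (h2 b hb).symm

theorem mem_graph_generator_iff_mem_generatorGraph {x y : X} :
    (x, y) ∈ (generator τ T).graph ↔ (x, y) ∈ generatorGraph τ T :=
  mem_graph_generator_iff τ T x y

theorem IsLaplace.isResolventAt (hT : IsBicontinuousSemigroup τ T) {M : ℝ}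
    (hM : ∀ t, ‖T t‖ ≤ M) {l : ℝ} (hl : 0 < l) {R : X →L[𝕜] X} (hR : IsLaplace τ T l R) :
    IsResolventAt (generator τ T) (l : 𝕜) R := by
  constructor
  · intro x
    have h := mem_graph_generator_iff_mem_generatorGraph.2 (hR.mem_generatorGraph hT hM hl x)
    obtain ⟨y, hy1, hy2⟩ := (LinearPMap.mem_graph_iff _).1 h
    simp only at hy1 hy2
    have hd : R x ∈ (generator τ T).domain := hy1 ▸ y.2
    refine ⟨hd, ?_⟩
    have : (⟨R x, hd⟩ : (generator τ T).domain) = y := Subtype.ext hy1.symm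
    rw [this, hy2]
    abel
  · intro y
    exact hR.apply_sub_of_mem_generatorGraph hT hM hl
      (mem_graph_generator_iff_mem_generatorGraph.1 ((generator τ T).mem_graph y))

theorem IsResolventAt.unique {A : X →ₗ.[𝕜] X} {μ : 𝕜} {R R' : X →L[𝕜] X}
    (h : IsResolventAt A μ R) (h' : IsResolventAt A μ R') : R = R' := by
  ext x
  obtain ⟨hd, hx⟩ := h'.1 x
  have := h.2 ⟨R' x, hd⟩
  simp only [hx] at this
  exact this

theorem IsResolventAt.resolvent_eq {A : X →ₗ.[𝕜] X} {μ : 𝕜} {R : X →L[𝕜] X}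
    (h : IsResolventAt A μ R) : resolvent A μ = R := by
  have hex : ∃ R : X →L[𝕜] X, IsResolventAt A μ R := ⟨R, h⟩
  rw [resolvent, dif_pos hex]
  exact hex.choose_spec.unique h

theorem IsResolventAt.value_eq {A : X →ₗ.[𝕜] X} {μ : 𝕜} {R : X →L[𝕜] X}
    (h : IsResolventAt A μ R) (x : X) : value A (R x) = μ • R x - x := by
  obtain ⟨hd, hx⟩ := h.1 x
  rw [value, dif_pos hd]
  exact (sub_eq_iff_eq_add'.2 (sub_eq_iff_eq_add.1 hx)).symm

end Generator

/-! ### Hölder decay of orbits versus decay of `A R(l, A)x` -/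

section Holder

variable {𝕜 : Type*} [RCLike 𝕜] {X : Type*} [NormedAddCommGroup X] [NormedSpace 𝕜 X]
  {τ : AdmissibleTopology 𝕜 X} {T : ℝ≥0 → X →L[𝕜] X}

/-- The kernel `l exp(-l t)` has total mass `1`, so `x` can be moved under the integral. -/
theorem IsLaplace.apply_smul_sub (hT : IsBicontinuousSemigroup τ T) {M : ℝ}
    (hM : ∀ t, ‖T t‖ ≤ M) {l : ℝ} (hl : 0 < l) {R : X →L[𝕜] X} (hR : IsLaplace τ T l R)
    {φ : X →L[𝕜] 𝕜} (hφ : τ.SeqCont φ) (x : X) :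
    φ ((l : 𝕜) • R x - x) = ∫ t in Set.Ioi (0 : ℝ),
      (l : 𝕜) * (((Real.exp (-l * t) : ℝ) : 𝕜) * φ (T t.toNNReal x - x)) := by
  have hl' : (l : 𝕜) ≠ 0 := by simpa using hl.ne'
  have h1 : ∫ t in Set.Ioi (0 : ℝ), ((Real.exp (-l * t) : ℝ) : 𝕜) = (l : 𝕜)⁻¹ := by
    rw [integral_ofReal, integral_exp_mul_Ioi (neg_lt_zero.2 hl)]
    simp
  have h2 : MeasureTheory.IntegrableOn (fun t : ℝ => ((Real.exp (-l * t) : ℝ) : 𝕜)) (Set.Ioi 0) :=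
    (exp_neg_integrableOn_Ioi 0 hl).ofReal
  simp only [map_sub, mul_sub]
  rw [MeasureTheory.integral_sub ((hT.integrableOn_laplace hM hl hφ x).const_mul _)
    ((h2.mul_const _).const_mul _), MeasureTheory.integral_const_mul,
    MeasureTheory.integral_const_mul, MeasureTheory.integral_mul_const, h1, ← hR φ hφ,
    mul_inv_cancel_left₀ hl', map_smul, smul_eq_mul]

theorem integrableOn_rpow_mul_exp_neg_mul {a r : ℝ} (ha : 0 < a) (hr : 0 < r) :
    MeasureTheory.IntegrableOn (fun t : ℝ => t ^ (a - 1) * Real.exp (-(r * t))) (Set.Ioi 0) := by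
  refine .of_integral_ne_zero ?_
  rw [Real.integral_rpow_mul_exp_neg_mul_Ioi ha hr]
  have := Real.Gamma_pos_of_pos ha
  positivity

/-- A Hölder type bound on an orbit of `T` gives a decay rate for `l R x - x = A R x`. -/
theorem IsLaplace.rpow_mul_seminorm_le (hT : IsBicontinuousSemigroup τ T) {M : ℝ}
    (hM : ∀ t, ‖T t‖ ≤ M) {l : ℝ} (hl : 0 < l) {R : X →L[𝕜] X} (hR : IsLaplace τ T l R)
    {q : Seminorm 𝕜 X} (hq : τ.DualSeminorm q) {α : ℝ} (hα : 0 < α) {a b : ℝ} {x : X}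
    (h : ∀ t : ℝ≥0, 0 < t → q (T t x - x) ≤ a * (t : ℝ) ^ α + b * (t : ℝ) ^ (α + 1)) :
    l ^ α * q ((l : 𝕜) • R x - x) ≤
      a * Real.Gamma (α + 1) + b * Real.Gamma (α + 2) * l⁻¹ := by
  have i1 := integrableOn_rpow_mul_exp_neg_mul (a := α + 1) (by linarith) hl
  have i2 := integrableOn_rpow_mul_exp_neg_mul (a := α + 2) (by linarith) hl
  have key : q ((l : 𝕜) • R x - x) ≤ l * (a * ((1 / l) ^ (α + 1) * Real.Gamma (α + 1)) +
      b * ((1 / l) ^ (α + 2) * Real.Gamma (α + 2))) := by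
    refine hq _ _ fun φ hφ hφq => ?_
    rw [hR.apply_smul_sub hT hM hl hφ,
      ← Real.integral_rpow_mul_exp_neg_mul_Ioi (by linarith : 0 < α + 1) hl,
      ← Real.integral_rpow_mul_exp_neg_mul_Ioi (by linarith : 0 < α + 2) hl,
      ← MeasureTheory.integral_const_mul, ← MeasureTheory.integral_const_mul,
      ← MeasureTheory.integral_add (i1.const_mul a) (i2.const_mul b),
      ← MeasureTheory.integral_const_mul]
    refine MeasureTheory.norm_integral_le_of_norm_le
      (((i1.const_mul a).add (i2.const_mul b)).const_mul l) ?_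
    filter_upwards [MeasureTheory.ae_restrict_mem measurableSet_Ioi] with t ht
    have ht' : 0 < t.toNNReal := Real.toNNReal_pos.2 ht
    have h1 := (hφq _).trans (h _ ht')
    rw [Real.coe_toNNReal t (le_of_lt ht)] at h1
    rw [norm_mul, norm_mul, norm_ofReal_exp, RCLike.norm_ofReal, abs_of_pos hl, add_sub_cancel_right,
      show α + 2 - 1 = α + 1 by ring, ← neg_mul]
    refine mul_le_mul_of_nonneg_left ?_ hl.le
    refine (mul_le_mul_of_nonneg_left h1 (Real.exp_pos _).le).trans (le_of_eq ?_)
    ring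
  refine (mul_le_mul_of_nonneg_left key (by positivity)).trans (le_of_eq ?_)
  have hp := Real.rpow_pos_of_pos hl α
  rw [one_div, Real.inv_rpow hl.le, Real.inv_rpow hl.le, show α + 2 = α + 1 + 1 by ring,
    Real.rpow_add_one hl.ne' (α + 1), Real.rpow_add_one hl.ne' α]
  field_simp

/-- A bound on the orbit of `y = l R x - x = A R x` up to time `t = 1 / l` controls `T t x - x`. -/
theorem IsLaplace.seminorm_semigroup_sub_le (hT : IsBicontinuousSemigroup τ T) {M : ℝ}
    (hM : ∀ t, ‖T t‖ ≤ M) {t : ℝ≥0} (ht : 0 < t) {R : X →L[𝕜] X}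
    (hR : IsLaplace τ T (t : ℝ)⁻¹ R)
    {q : Seminorm 𝕜 X} (hq : τ.DualSeminorm q) {B : ℝ} {x : X}
    (h : ∀ s ≤ t, q (T s ((((t : ℝ)⁻¹ : ℝ) : 𝕜) • R x - x)) ≤ B) :
    q (T t x - x) ≤ 3 * B := by
  have ht' : (0 : ℝ) < t := ht
  set c : 𝕜 := (((t : ℝ)⁻¹ : ℝ) : 𝕜) with hc
  set y := c • R x - x with hy
  -- Since `A R x = y`, the first term is the mean of `T(s)y` over `[0, t]`. It and the two terms of
  -- `T t y - y` contribute `B` each.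
  have e : T t x - x = c • (T t (R x) - R x) - (T t y - y) := by
    rw [hy, map_sub, map_smul, smul_sub]
    abel
  refine hq _ _ fun φ hφ hφq => ?_
  rw [e, map_sub, map_smul, apply_semigroup_sub_eq_integral hT hM
    (hR.mem_generatorGraph hT hM (inv_pos.2 ht') x) hφ, map_sub]
  have h1 := intervalIntegral.norm_integral_le_of_norm_le_const (a := 0) (b := (t : ℝ)) (C := B)
    (f := fun s : ℝ => φ (T s.toNNReal y)) fun s hs => by
      rw [Set.uIoc_of_le ht'.le] at hs
      exact (hφq _).trans (h _ (Real.toNNReal_le_iff_le_coe.2 hs.2))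
  rw [sub_zero, abs_of_pos ht'] at h1
  have h2 : ‖c • ∫ s in (0 : ℝ)..t, φ (T s.toNNReal y)‖ ≤ B := by
    rw [norm_smul, hc, RCLike.norm_ofReal, abs_of_pos (inv_pos.2 ht'), inv_mul_le_iff₀ ht',
      mul_comm]
    exact h1
  have h3 : ‖φ (T t y)‖ ≤ B := (hφq _).trans (h t le_rfl)
  have h4 : ‖φ y‖ ≤ B := by
    have := (hφq _).trans (h 0 t.2)
    rwa [hT.map_zero] at this
  refine (norm_sub_le _ _).trans ((add_le_add h2 ((norm_sub_le _ _).trans (add_le_add h3 h4))).trans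
    (le_of_eq ?_))
  ring

theorem seminorm_ofReal_smul (q : Seminorm 𝕜 X) {r : ℝ} (hr : 0 ≤ r) (x : X) :
    q ((r : 𝕜) • x) = r * q x := by
  rw [map_smul_eq_mul, RCLike.norm_ofReal, abs_of_nonneg hr]

theorem tendsto_rpow_smul_of_mem_holderSpace (hT : IsBicontinuousSemigroup τ T) {M : ℝ}
    (hM : ∀ t, ‖T t‖ ≤ M) {R : ℝ → X →L[𝕜] X} (hR : ∀ l, 0 < l → IsLaplace τ T l (R l))
    {α : ℝ} (hα : 0 < α) {x : X} (hx : x ∈ holderSpace τ T α) :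
    Tendsto (fun l : ℝ => ((l ^ α : ℝ) : 𝕜) • ((l : 𝕜) • R l x - x)) atTop (@nhds X τ.top 0) := by
  obtain ⟨hx0, C, hC⟩ := hx
  rw [τ.tendsto_zero_iff] at hx0 ⊢
  intro p hp
  obtain ⟨K, hK0, hK⟩ := hp.exists_bound
  have hC0 : 0 ≤ C := by
    refine le_trans ?_ (hC 1 zero_lt_one)
    positivity
  rw [Metric.tendsto_nhds]
  intro ε hε
  have hΓ : 0 < Real.Gamma (α + 1) := Real.Gamma_pos_of_pos (by linarith)
  -- Chosen so that the part coming from small times contributes exactly `ε / 2`.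
  set η := ε / 2 / Real.Gamma (α + 1) with hη
  have hη0 : 0 < η := by positivity
  have h1 := (hx0 p hp).eventually (gt_mem_nhds hη0)
  obtain ⟨δ, hδ, h1⟩ : ∃ δ : ℝ, 0 < δ ∧ ∀ t : ℝ≥0, 0 < t → (t : ℝ) < δ →
      p (((((t : ℝ) ^ α : ℝ) : 𝕜))⁻¹ • (T t x - x)) < η := by
    obtain ⟨δ, hδ, h⟩ := Metric.mem_nhdsWithin_iff.1 h1
    refine ⟨δ, hδ, fun t ht htδ => h ⟨?_, ht⟩⟩
    rw [Metric.mem_ball, NNReal.dist_eq, NNReal.coe_zero, sub_zero, abs_of_nonneg (NNReal.coe_nonneg t)]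
    exact htδ
  -- Smallness in `p` is known only for `t < δ`. For `t ≥ δ` the factor `t / δ ≥ 1` raises the power
  -- of `t` in the norm bound, which yields an extra `l⁻¹` after integration.
  have hbound : ∀ t : ℝ≥0, 0 < t →
      p (T t x - x) ≤ η * (t : ℝ) ^ α + K * C / δ * (t : ℝ) ^ (α + 1) := by
    intro t ht
    have ht' : (0 : ℝ) < t := ht
    have hpos := Real.rpow_pos_of_pos ht' α
    rw [Real.rpow_add_one ht'.ne']
    rcases lt_or_ge (t : ℝ) δ with htδ | htδ
    · have := h1 t ht htδ
      rw [← RCLike.ofReal_inv, seminorm_ofReal_smul p (by positivity),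
        inv_mul_lt_iff₀ hpos] at this
      have h2 : 0 ≤ K * C / δ * ((t : ℝ) ^ α * t) := by positivity
      linarith
    · have h2 := (hK (T t x - x)).trans
        (mul_le_mul_of_nonneg_left ((div_le_iff₀ hpos).1 (hC t ht)) hK0)
      have h3 : K * (C * (t : ℝ) ^ α) ≤ K * C / δ * ((t : ℝ) ^ α * t) := by
        rw [div_mul_eq_mul_div, le_div_iff₀ hδ]
        have : K * (C * (t : ℝ) ^ α) * δ ≤ K * (C * (t : ℝ) ^ α) * t := by gcongr
        linarith
      have h4 : 0 ≤ η * (t : ℝ) ^ α := by positivity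
      linarith
  have h2 : Tendsto (fun l : ℝ => K * C / δ * Real.Gamma (α + 2) * l⁻¹) atTop (𝓝 0) := by
    simpa using tendsto_inv_atTop_zero.const_mul (K * C / δ * Real.Gamma (α + 2))
  filter_upwards [h2.eventually (gt_mem_nhds (half_pos hε)), eventually_gt_atTop 0] with l hl2 hl
  rw [Real.dist_eq, sub_zero, abs_of_nonneg (apply_nonneg _ _),
    seminorm_ofReal_smul p (Real.rpow_nonneg hl.le α)]
  refine ((hR l hl).rpow_mul_seminorm_le hT hM hl hp.dualSeminorm hα hbound).trans_lt ?_
  have : η * Real.Gamma (α + 1) = ε / 2 := div_mul_cancel₀ _ hΓ.ne'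
  linarith

theorem exists_norm_rpow_smul_le_of_mem_holderSpace (hT : IsBicontinuousSemigroup τ T) {M : ℝ}
    (hM : ∀ t, ‖T t‖ ≤ M) {R : ℝ → X →L[𝕜] X} (hR : ∀ l, 0 < l → IsLaplace τ T l (R l))
    {α : ℝ} (hα : 0 < α) {x : X} (hx : x ∈ holderSpace τ T α) :
    ∃ C : ℝ, ∀ l : ℝ, 0 < l → ‖((l ^ α : ℝ) : 𝕜) • ((l : 𝕜) • R l x - x)‖ ≤ C := by
  obtain ⟨-, C, hC⟩ := hx
  refine ⟨C * Real.Gamma (α + 1), fun l hl => ?_⟩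
  have := (hR l hl).rpow_mul_seminorm_le hT hM hl τ.dualSeminorm_norm hα (a := C) (b := 0) (x := x)
    fun t ht => by
      rw [zero_mul, add_zero]
      exact (div_le_iff₀ (Real.rpow_pos_of_pos (NNReal.coe_pos.2 ht) α)).1 (hC t ht)
  rw [zero_mul, zero_mul, add_zero] at this
  rw [norm_smul, RCLike.norm_ofReal, abs_of_pos (Real.rpow_pos_of_pos hl α)]
  exact this

theorem mem_holderSpace_of_tendsto_of_bounded (hT : IsBicontinuousSemigroup τ T) {M : ℝ}
    (hM : ∀ t, ‖T t‖ ≤ M) {R : ℝ → X →L[𝕜] X} (hR : ∀ l, 0 < l → IsLaplace τ T l (R l))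
    {α : ℝ} (hα : 0 < α) {x : X}
    (hx : Tendsto (fun l : ℝ => ((l ^ α : ℝ) : 𝕜) • ((l : 𝕜) • R l x - x)) atTop (@nhds X τ.top 0))
    {C : ℝ} (hC : ∀ l : ℝ, 0 < l → ‖((l ^ α : ℝ) : 𝕜) • ((l : 𝕜) • R l x - x)‖ ≤ C) :
    x ∈ holderSpace τ T α := by
  have hC0 : 0 ≤ C := (norm_nonneg _).trans (hC 1 zero_lt_one)
  have hcoe : ∀ t : ℝ≥0, ((((t : ℝ)⁻¹) ^ α : ℝ)) = ((t : ℝ) ^ α)⁻¹ := fun t =>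
    Real.inv_rpow t.2 α
  refine ⟨tendsto_of_seq_tendsto fun u hu => ?_, 3 * (M * C), fun t ht => ?_⟩
  · let v : ℕ → X := fun n => ((((u n : ℝ)⁻¹) ^ α : ℝ) : 𝕜) •
      ((((u n : ℝ)⁻¹ : ℝ) : 𝕜) • R (u n : ℝ)⁻¹ x - x)
    have hvC : ∀ n, ‖v n‖ ≤ C := by
      intro n
      -- `u n` is positive only eventually; where it vanishes, `0⁻¹ = 0` and `0 ^ α = 0` make `v n =
      -- 0`.
      rcases eq_zero_or_pos (u n) with h0 | h0
      · simpa [v, h0, Real.zero_rpow hα.ne'] using hC0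
      · exact hC _ (inv_pos.2 (NNReal.coe_pos.2 h0))
    have hv : Tendsto v atTop (@nhds X τ.top 0) :=
      hx.comp (tendsto_inv_nhdsGT_zero.comp (tendsto_coe_nhdsGT_zero.comp hu))
    rw [τ.tendsto_zero_iff]
    intro p hp
    rw [Metric.tendsto_nhds]
    intro ε hε
    -- The estimate below costs a factor `3`, and `3 * (ε / 4) < ε`.
    have hU : {z : X | p z < ε / 4} ∈ @nhds X τ.top 0 := by
      have := @Continuous.tendsto X ℝ τ.top _ _ hp 0
      rw [_root_.map_zero] at this
      exact this.eventually (gt_mem_nhds (by positivity))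
    have hu0 : ∀ᶠ n in atTop, 0 < u n := hu.eventually self_mem_nhdsWithin
    have hu1 : ∀ᶠ n in atTop, u n ≤ 1 :=
      (hu.mono_right nhdsWithin_le_nhds).eventually (ge_mem_nhds zero_lt_one)
    -- Eventually `[0, u n] ⊆ [0, 1]`, so bi-equicontinuity on one fixed interval controls `T(s)(v
    -- n)` for all `s ≤ u n`.
    filter_upwards [hT.locBiequicont v ⟨C, hvC⟩ hv 1 _ hU, hu0, hu1] with n hn hn0 hn1
    have hpos : 0 < (u n : ℝ) ^ α := Real.rpow_pos_of_pos (NNReal.coe_pos.2 hn0) α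
    have h1 := (hR _ (inv_pos.2 (NNReal.coe_pos.2 hn0))).seminorm_semigroup_sub_le hT hM hn0
      hp.dualSeminorm (B := (u n : ℝ) ^ α * (ε / 4)) (x := x) fun s hs => by
        have h2 : p (T s (v n)) < ε / 4 := hn s (hs.trans hn1)
        simp only [v, map_smul (T s)] at h2
        rw [hcoe, seminorm_ofReal_smul p (inv_pos.2 hpos).le, inv_mul_lt_iff₀ hpos] at h2
        exact h2.le
    rw [Real.dist_eq, sub_zero, abs_of_nonneg (apply_nonneg _ _), Function.comp_apply, ← RCLike.ofReal_inv,
      seminorm_ofReal_smul p (inv_pos.2 hpos).le, inv_mul_lt_iff₀ hpos]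
    refine h1.trans_lt ?_
    nlinarith
  · have hpos : 0 < (t : ℝ) ^ α := Real.rpow_pos_of_pos (NNReal.coe_pos.2 ht) α
    have hl : 0 < (t : ℝ)⁻¹ := inv_pos.2 (NNReal.coe_pos.2 ht)
    rw [div_le_iff₀ hpos]
    refine ((hR _ hl).seminorm_semigroup_sub_le hT hM ht
      τ.dualSeminorm_norm (B := M * (C * (t : ℝ) ^ α)) (x := x) fun s hs => ?_).trans
      (le_of_eq (by ring))
    have h2 := hC _ hl
    rw [hcoe, norm_smul, RCLike.norm_ofReal, abs_of_pos (inv_pos.2 hpos), inv_mul_le_iff₀ hpos,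
      mul_comm] at h2
    exact (T s).le_of_opNorm_le_of_le (hM s) h2

end Holder

end BiCont

theorem mainTheorem6 {𝕜 : Type*} [RCLike 𝕜] {X : Type*} [NormedAddCommGroup X] [NormedSpace 𝕜 X]
    [CompleteSpace X] (τ : BiCont.AdmissibleTopology 𝕜 X)
    (T : ℝ≥0 → X →L[𝕜] X) (hT : BiCont.IsBicontinuousSemigroup τ T)
    (hneg : BiCont.HasNegativeGrowthBound T) (α : ℝ) (hα : α ∈ Set.Ioo (0 : ℝ) 1) :
    (∀ l : ℝ, 0 < l → (l : 𝕜) ∈ BiCont.resolventSet (BiCont.generator τ T)) ∧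
    BiCont.holderSpace τ T α =
      {x : X |
        Tendsto (fun l : ℝ => ((l ^ α : ℝ) : 𝕜) •
            BiCont.value (BiCont.generator τ T)
              (BiCont.resolvent (BiCont.generator τ T) (l : 𝕜) x))
          atTop (@nhds X τ.top 0) ∧
        ∃ C : ℝ, ∀ l : ℝ, 0 < l →
          ‖((l ^ α : ℝ) : 𝕜) •
            BiCont.value (BiCont.generator τ T)
              (BiCont.resolvent (BiCont.generator τ T) (l : 𝕜) x)‖ ≤ C} := by
  obtain ⟨M, -, hM⟩ := hneg.exists_norm_le
  have hex : ∀ l : ℝ, ∃ R, 0 < l → BiCont.IsLaplace τ T l R := fun l => by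
    by_cases hl : 0 < l
    · exact (hT.exists_isLaplace hM hl).imp fun R hR _ => hR
    · exact ⟨0, fun h => absurd h hl⟩
  choose R hR using hex
  have hres := fun l (hl : 0 < l) => (hR l hl).isResolventAt hT hM hl
  have hval : ∀ l : ℝ, 0 < l → ∀ x, BiCont.value (BiCont.generator τ T)
      (BiCont.resolvent (BiCont.generator τ T) (l : 𝕜) x) = (l : 𝕜) • R l x - x := fun l hl x => by
    rw [(hres l hl).resolvent_eq, (hres l hl).value_eq]
  refine ⟨fun l hl => ⟨R l, hres l hl⟩, Set.ext fun x => ?_⟩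
  have hev : (fun l : ℝ => ((l ^ α : ℝ) : 𝕜) • BiCont.value (BiCont.generator τ T)
      (BiCont.resolvent (BiCont.generator τ T) (l : 𝕜) x)) =ᶠ[atTop]
      fun l : ℝ => ((l ^ α : ℝ) : 𝕜) • ((l : 𝕜) • R l x - x) := by
    filter_upwards [eventually_gt_atTop 0] with l hl
    rw [hval l hl]
  constructor
  · intro hx
    refine ⟨(BiCont.tendsto_rpow_smul_of_mem_holderSpace hT hM hR hα.1 hx).congr' hev.symm, ?_⟩
    obtain ⟨C, hC⟩ := BiCont.exists_norm_rpow_smul_le_of_mem_holderSpace hT hM hR hα.1 hx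
    exact ⟨C, fun l hl => by rw [hval l hl]; exact hC l hl⟩
  · rintro ⟨hx, C, hC⟩
    exact BiCont.mem_holderSpace_of_tendsto_of_bounded hT hM hR hα.1 (hx.congr' hev)
      fun l hl => by rw [← hval l hl]; exact hC l hl
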